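/- **Setting.** Let $n, M\ge 1$. On the Hilbert space of $n$ qubits consider the parametrized circuit $$U(\phi)=W_MU_M(\phi_M)\cdots W_2U_2(\phi_2)\,W_1U_1(\phi_1),\qquad U_i(t)=e^{-it\sigma_i},\qquad \phi\in\mathbb R^M,$$ where each $\sigma_i$ is a Pauli string and each $W_i$ is a fixed unitary. Let $H$ be a Hermitian operator and let $|E_{\rm m}|$ be the largest absolute value of an eigenvalue of $H$. Let $\psi_0,\psi_1$ be orthonormal states, $\psi_+=(\psi_0+\psi_1)/\sqrt2$ and $\rho_j=|\psi_j\rangle\langle\psi_j|$. For $\bar\phi\in\mathbb R^M$ (the previous optimum; the statement holds for every $\bar\phi$) and a time step $\delta t\ge 0$ let $$C(\phi)=\frac13\sum_{j\in\{0,1,+\}}\Bigl(1-\bigl|\langle\psi_j|U(\phi)^\dagger e^{-iH\delta t}U(\bar\phi)|\psi_j\rangle\bigr|^2\Bigr).$$ For $r>0$ let $\mathcal D(\bar\phi,r)$ be the uniform distribution on the hypercube $\prod_i[\bar\phi_i-r,\bar\phi_i+r]$. Put $$s=\frac13\sum_{j\in\{0,1,+\}}\mathrm{Tr}[\sigma_1\rho_j\sigma_1\rho_j],\qquad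 D=1-s-2|E_{\rm m}|\,\delta t-2E_{\rm m}^2\,\delta t^2 .$$ For $r_0\in(0,1)$ consider the two conditions $$\text{(A)}\quad 2|E_{\rm m}|\,\delta t<\sqrt{3-2s}-1,\qquad\qquad \text{(B)}\quad (M-1)\,r^2\le 3r_0^2\,\frac{D}{1+D}.$$ **Theorem.** 1. If $r>0$ and (A) and (B) hold for some $r_0\in(0,1)$, then $$\mathrm{Var}_{\phi\sim\mathcal D(\bar\phi,r)}[C(\phi)]\ \ge\ \frac{4r^4}{45}\Bigl(1-\frac{4r^2}{7}\Bigr)(1-r_0^2)^2\Bigl(1-s-2|E_{\rm m}|\,\delta t-2E_{\rm m}^2\,\delta t^2\Bigr)^2 .$$ 2. Let $p$ be a real polynomial that is positive at all positive integers and let $r_0\in(0,1)$. Consider all instances as above (with arbitrary $n,M$) in which $|\langle\psi_j|\sigma_1|\psi_j\rangle|\le 1-1/p(n)$ for some $j\in\{0,1,+\}$. (a) For every $\kappa\in(0,1)$ there is a constant $b>0$, depending only on $p,r_0,\kappa$, such that whenever $2|E_{\rm m}|\,\delta t\le\kappa(\sqrt{3-2s}-1)$, every $r$ with $0<r\le b/\sqrt{M\,p(n)}$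 satisfies (B). Thus perturbations of order $1/\sqrt M$, up to polynomial factors in $n$, are allowed. (b) For every real polynomial $q$ that is positive at all positive integers there is a polynomial $P$, positive at all positive integers and depending only on $p,q,r_0$, such that whenever $M\ge2$, (A) and (B) hold and $r\ge 1/(q(n)\sqrt M)$, $$\mathrm{Var}_{\phi\sim\mathcal D(\bar\phi,r)}[C(\phi)]\ \ge\ \frac{1}{M^2P(n)} .$$ In particular, for admissible $r\in\Theta(1/\sqrt M)$ the variance is $\Omega(1/(M^2\,\mathrm{poly}(n)))$; this is the sense in which the region is free of barren plateaus. -/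

import Mathlib

open MeasureTheory ProbabilityTheory
open scoped Matrix

noncomputable section

namespace VQS

/-- Labels of the computational basis of `n` qubits. -/
abbrev Bits (n : ℕ) : Type := Fin n → Fin 2

/-- Operators on `n` qubits, as matrices in the computational basis. -/
abbrev Op (n : ℕ) : Type := Matrix (Bits n) (Bits n) ℂ

/-- The Hilbert space of `n` qubits. -/
abbrev Ket (n : ℕ) : Type := EuclideanSpace ℂ (Bits n)

/-- Labels of the single-qubit Pauli matrices (including the identity). -/
inductive Pauli where
  | I
  | X
  | Y
  | Z

/-- The single-qubit Pauli matrices. -/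
def Pauli.toMatrix : Pauli → Matrix (Fin 2) (Fin 2) ℂ
  | .I => 1
  | .X => !![0, 1; 1, 0]
  | .Y => !![0, -Complex.I; Complex.I, 0]
  | .Z => !![1, 0; 0, -1]

/-- The Pauli string `P₁ ⊗ ⋯ ⊗ Pₙ`, as a matrix in the computational basis. -/
def pauliString {n : ℕ} (P : Fin n → Pauli) : Op n :=
  Matrix.of fun x y => ∏ k, (P k).toMatrix (x k) (y k)

/-- The matrix element `⟨φ|A|ψ⟩`. -/
def braket {n : ℕ} (φ : Ket n) (A : Op n) (ψ : Ket n) : ℂ :=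
  star φ.ofLp ⬝ᵥ (A *ᵥ ψ.ofLp)

/-- The density matrix `|ψ⟩⟨ψ|`. -/
def density {n : ℕ} (ψ : Ket n) : Op n :=
  Matrix.vecMulVec ψ.ofLp (star ψ.ofLp)

/-- The data on `n` qubits: a circuit with `M` parametrized gates generated by Pauli strings and
`M` fixed unitary gates, a Hamiltonian, and two orthonormal initial states. -/
structure Model (n M : ℕ) where
  /-- The Pauli strings generating the parametrized gates, in the order of application. -/
  gen : Fin M → Fin n → Pauli
  /-- The fixed gates. -/
  W : Fin M → Matrix.unitaryGroup (Bits n) ℂ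
  /-- The Hamiltonian. -/
  H : Op n
  isHermitian : H.IsHermitian
  /-- The two initial states spanning the simulated subspace. -/
  init : Fin 2 → Ket n
  orthonormal : Orthonormal ℂ init

namespace Model

variable {n M : ℕ} (S : Model n M)

/-- The generator `σᵢ` of the `i`-th parametrized gate. -/
def σ (i : Fin M) : Op n := pauliString (S.gen i)

/-- The `i`-th parametrized gate `Uᵢ(t) = exp(-i t σᵢ)`. -/
def gate (i : Fin M) (t : ℝ) : Op n :=
  NormedSpace.exp ((-(Complex.I * (t : ℂ))) • S.σ i)

/-- The circuit `U(φ) = W_M U_M(φ_M) ⋯ W_2 U_2(φ_2) W_1 U_1(φ_1)`; the gate with index `1` acts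
first on the input state. -/
def circuit (φ : Fin M → ℝ) : Op n :=
  (List.ofFn fun i : Fin M => (S.W i : Op n) * S.gate i (φ i)).reverse.prod

/-- The exact time evolution `exp(-i H δt)`. -/
def evolution (δt : ℝ) : Op n :=
  NormedSpace.exp ((-(Complex.I * (δt : ℂ))) • S.H)

/-- The three training states `ψ₀`, `ψ₁` and `ψ₊ = (ψ₀ + ψ₁) / √2`. -/
def state : Fin 3 → Ket n :=
  ![S.init 0, S.init 1, ((Real.sqrt 2 : ℂ)⁻¹) • (S.init 0 + S.init 1)]

/-- The infidelity `C_j(φ) = 1 - |⟨ψ_j| U(φ)† exp(-i H δt) U(φbar) |ψ_j⟩|²`. -/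
def costTerm (φbar : Fin M → ℝ) (δt : ℝ) (j : Fin 3) (φ : Fin M → ℝ) : ℝ :=
  1 - ‖braket (S.state j) ((S.circuit φ)ᴴ * S.evolution δt * S.circuit φbar) (S.state j)‖ ^ 2

/-- The cost function, the average of the three infidelities. -/
def cost (φbar : Fin M → ℝ) (δt : ℝ) (φ : Fin M → ℝ) : ℝ :=
  (1 / 3) * ∑ j, S.costTerm φbar δt j φ

/-- `|E_m|`, the largest absolute value of an eigenvalue of the Hamiltonian. -/
def maxAbsEnergy : ℝ := ⨆ i, |S.isHermitian.eigenvalues i|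

/-- `(1/3) ∑_j Tr[σ₁ ρ_j σ₁ ρ_j]`, where `σ₁` generates the first gate and `ρ_j = |ψ_j⟩⟨ψ_j|`. -/
def meanOverlap [NeZero M] : ℝ :=
  (1 / 3) * ∑ j,
    (Matrix.trace (S.σ 0 * density (S.state j) * S.σ 0 * density (S.state j))).re

/-- `1 - (1/3) ∑_j Tr[σ₁ ρ_j σ₁ ρ_j] - 2 |E_m| δt - 2 E_m² δt²`. -/
def margin [NeZero M] (δt : ℝ) : ℝ :=
  1 - S.meanOverlap - 2 * S.maxAbsEnergy * δt - 2 * S.maxAbsEnergy ^ 2 * δt ^ 2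

end Model

/-- The hypercube of half side `r` around `φ`. -/
def hypercube {M : ℕ} (φ : Fin M → ℝ) (r : ℝ) : Set (Fin M → ℝ) :=
  {θ | ∀ i, θ i ∈ Set.Icc (φ i - r) (φ i + r)}

/-- The uniform distribution on the hypercube: normalized Lebesgue measure. -/
def uniformCube {M : ℕ} (φ : Fin M → ℝ) (r : ℝ) : Measure (Fin M → ℝ) :=
  cond volume (hypercube φ r)

/-- A real polynomial that is positive at all positive integers. -/
def PosPoly (p : Polynomial ℝ) : Prop := ∀ n : ℕ, 1 ≤ n → 0 < p.eval (n : ℝ)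

end VQS

end

/-!
The cost is `1 - F`, where `F` is the mean of three fidelities. A gate `exp (-i t σ)` generated by
an involution is `cos t - i sin t σ`, so every amplitude is a combination of `cos t` and `sin t` in
each parameter, and `F` is, in each parameter separately, of the form
`α + β cos (2 t) + γ sin (2 t)` (`VQS.IsTrig`, `VQS.Model.isTrig_meanFidelity`).

*Variance.* In terms of the first parameter `t`, measured from the centre of the cube, the
covariance of `F` with `cos (2 t)` is `E[β] Var[cos (2 t)]`, since the coordinates are independent
and the sine is odd. Hence `Var F ≥ E[β]² Var[cos (2 t)]` (`VQS.IsTrig.variance_ge`). An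
alternating Taylor bound gives `Var[cos (2 t)] ≥ 16 r⁴ / 45 * (1 - 4 r² / 7)`
(`VQS.varCosTwo_ge`).

*The coefficient.* The number `2 β` is the difference `G` of the values of `F` at the centre and
at distance `π / 2` in the first parameter, as a function of the other `M - 1` parameters. As
`0 ≤ F ≤ 1`, the function `1 + G` is nonnegative. Averaging a nonnegative function of this
trigonometric form over one coordinate gives at least `E[cos² t] ≥ 1 - r² / 3` times its mean with
that coordinate fixed at the centre. Iterating over the coordinates and using Bernoulli's
inequality gives `E[1 + G] ≥ (1 - (M - 1) r² / 3) (1 + G₀)` with `G₀` the value at the centre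
(`VQS.IsTrig.integral_ge_center`). If `G₀ ≥ D`, the condition on `(M - 1) r²` turns this into
`E[G] ≥ (1 - r₀²) D` (`VQS.IsTrig.variance_ge_of_gap`).

*The gap at the centre.* Shifting the first gate by `π / 2` replaces the input state `ψ` by
`-i σ₁ ψ`. Since `exp (-i H δt)` moves a state by at most `x = |E_m| δt`, the fidelity at the
centre is at least `1 - x²`, and the shifted one is at most `(|⟨ψ|σ₁|ψ⟩| + x)²`. Their difference,
averaged over the states, is at least the margin `D = 1 - s - 2 x - 2 x²`
(`VQS.Model.margin_le_gap`). The condition on the time step says that this quadratic polynomial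
in `x` is positive.

*Scaling.* A fraction `κ` of the largest time step leaves `D ≥ (1 - κ) (1 - s)`
(`VQS.Model.margin_ge`), and `1 - s ≥ 1 / (3 p)`. Conversely, the condition on `(M - 1) r²`
together with `r ≥ 1 / (q √M)` bounds `D` below by a multiple of `1 / q²` and gives `r² ≤ 3 / 2`,
so that the variance bound is at least a multiple of `1 / (M² q⁸)`.
-/

namespace VQS

/-! ### A Taylor bound for the cosine -/

theorem nonneg_of_deriv_nonneg {f f' : ℝ → ℝ} (h0 : f 0 = 0)
    (hf : ∀ x, HasDerivAt f (f' x) x) (hf' : ∀ x, 0 ≤ x → 0 ≤ f' x) {x : ℝ} (hx : 0 ≤ x) :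
    0 ≤ f x := by
  have hmono : MonotoneOn f (Set.Ici 0) := by
    refine monotoneOn_of_deriv_nonneg (convex_Ici 0)
      (fun x _ => (hf x).continuousAt.continuousWithinAt)
      (fun x _ => (hf x).differentiableAt.differentiableWithinAt) fun x hx' => ?_
    rw [(hf x).deriv]
    exact hf' x (interior_subset hx')
  simpa [h0] using hmono (Set.mem_Ici.2 le_rfl) (Set.mem_Ici.2 hx) hx

theorem sub_cube_le_sin {x : ℝ} (hx : 0 ≤ x) : 0 ≤ Real.sin x - x + x ^ 3 / 6 := by
  refine nonneg_of_deriv_nonneg (f := fun x => Real.sin x - x + x ^ 3 / 6)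
    (f' := fun x => Real.cos x - 1 + x ^ 2 / 2) (by simp) (fun x => ?_) (fun x _ => ?_) hx
  · refine (((Real.hasDerivAt_sin x).sub (hasDerivAt_id x)).add
      ((hasDerivAt_pow 3 x).div_const 6)).congr_deriv ?_
    simp; ring
  · linarith [Real.one_sub_sq_div_two_le_cos (x := x)]

/-- The alternating Taylor bound for the variance of `cos`: the fourth derivative of the left
hand side is `(x / 2) * (sin x - x + x ^ 3 / 6)`. -/
theorem cos_variance_taylor {x : ℝ} (hx : 0 ≤ x) :
    0 ≤ x ^ 2 / 2 + x * Real.sin x / 2 - 2 * (1 - Real.cos x) - x ^ 6 / 720 + x ^ 8 / 20160 := by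
  have hid := fun x : ℝ => hasDerivAt_id x
  have hs := Real.hasDerivAt_sin
  have hc := Real.hasDerivAt_cos
  have h3 : ∀ x : ℝ, 0 ≤ x →
      0 ≤ (Real.sin x - x * Real.cos x) / 2 - x ^ 3 / 6 + x ^ 5 / 60 := fun x hx => by
    refine nonneg_of_deriv_nonneg
      (f := fun x => (Real.sin x - x * Real.cos x) / 2 - x ^ 3 / 6 + x ^ 5 / 60)
      (f' := fun x => x / 2 * (Real.sin x - x + x ^ 3 / 6)) (by simp) (fun x => ?_)
      (fun x hx => mul_nonneg (by positivity) (sub_cube_le_sin hx)) hx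
    refine (((((hs x).sub ((hid x).mul (hc x))).div_const 2).sub
      ((hasDerivAt_pow 3 x).div_const 6)).add ((hasDerivAt_pow 5 x).div_const 60)).congr_deriv ?_
    simp; ring
  have h2 : ∀ x : ℝ, 0 ≤ x →
      0 ≤ 1 - Real.cos x - x * Real.sin x / 2 - x ^ 4 / 24 + x ^ 6 / 360 := fun x hx => by
    refine nonneg_of_deriv_nonneg
      (f := fun x => 1 - Real.cos x - x * Real.sin x / 2 - x ^ 4 / 24 + x ^ 6 / 360)
      (by simp) (fun x => ?_) h3 hx
    refine (((((hc x).const_sub 1).sub (((hid x).mul (hs x)).div_const 2)).sub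
      ((hasDerivAt_pow 4 x).div_const 24)).add ((hasDerivAt_pow 6 x).div_const 360)).congr_deriv ?_
    simp; ring
  have h1 : ∀ x : ℝ, 0 ≤ x →
      0 ≤ x + x * Real.cos x / 2 - 3 / 2 * Real.sin x - x ^ 5 / 120 + x ^ 7 / 2520 :=
    fun x hx => by
    refine nonneg_of_deriv_nonneg
      (f := fun x => x + x * Real.cos x / 2 - 3 / 2 * Real.sin x - x ^ 5 / 120 + x ^ 7 / 2520)
      (by simp) (fun x => ?_) h2 hx
    refine (((((hid x).add (((hid x).mul (hc x)).div_const 2)).sub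
      ((hs x).const_mul (3 / 2))).sub
      ((hasDerivAt_pow 5 x).div_const 120)).add ((hasDerivAt_pow 7 x).div_const 2520)).congr_deriv ?_
    simp; ring
  refine nonneg_of_deriv_nonneg
    (f := fun x => x ^ 2 / 2 + x * Real.sin x / 2 - 2 * (1 - Real.cos x) - x ^ 6 / 720 +
      x ^ 8 / 20160) (by simp) (fun x => ?_) h1 hx
  refine ((((((hasDerivAt_pow 2 x).div_const 2).add (((hid x).mul (hs x)).div_const 2)).sub
    (((hc x).const_sub 1).const_mul 2)).sub
    ((hasDerivAt_pow 6 x).div_const 720)).add ((hasDerivAt_pow 8 x).div_const 20160)).congr_deriv ?_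
  simp; ring

/-! ### The uniform distribution on a cube -/

theorem hypercube_eq_pi {M : ℕ} (φ : Fin M → ℝ) (r : ℝ) :
    hypercube φ r = Set.univ.pi fun i => Set.Icc (φ i - r) (φ i + r) := by
  ext; simp only [hypercube, Set.mem_ofPred_eq, Set.mem_univ_pi]

theorem isProbabilityMeasure_cond_Icc (c : ℝ) {r : ℝ} (hr : 0 < r) :
    IsProbabilityMeasure (cond (volume : Measure ℝ) (Set.Icc (c - r) (c + r))) := by
  refine cond_isProbabilityMeasure_of_finite ?_ ?_ <;> simp [Real.volume_Icc]
  linarith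

theorem uniformCube_eq_pi {M : ℕ} (φ : Fin M → ℝ) {r : ℝ} (hr : 0 < r) :
    uniformCube φ r =
      Measure.pi fun i => cond (volume : Measure ℝ) (Set.Icc (φ i - r) (φ i + r)) := by
  have := fun i => isProbabilityMeasure_cond_Icc (φ i) hr
  refine (Measure.pi_eq fun s _ => ?_).symm
  rw [uniformCube, hypercube_eq_pi, cond_apply (MeasurableSet.univ_pi fun i => measurableSet_Icc),
    ← Set.pi_inter_distrib, volume_pi, Measure.pi_pi, Measure.pi_pi]
  simp only [cond_apply measurableSet_Icc]
  rw [Finset.prod_mul_distrib, ENNReal.prod_inv_distrib]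
  intro i _ j _ _
  simp [Real.volume_Icc]

theorem isProbabilityMeasure_uniformCube {M : ℕ} (φ : Fin M → ℝ) {r : ℝ} (hr : 0 < r) :
    IsProbabilityMeasure (uniformCube φ r) := by
  have := fun i => isProbabilityMeasure_cond_Icc (φ i) hr
  rw [uniformCube_eq_pi φ hr]
  infer_instance

theorem integral_uniformCube_coord {M : ℕ} (φ : Fin M → ℝ) {r : ℝ} (hr : 0 < r) (i : Fin M)
    {f : ℝ → ℝ} (hf : Continuous f) :
    ∫ θ, f (θ i - φ i) ∂uniformCube φ r = (2 * r)⁻¹ * ∫ t in -r..r, f t := by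
  have := fun i => isProbabilityMeasure_cond_Icc (φ i) hr
  rw [uniformCube_eq_pi φ hr]
  have h := (measurePreserving_eval (fun i => cond (volume : Measure ℝ)
    (Set.Icc (φ i - r) (φ i + r))) i)
  have h2 := integral_map (μ := Measure.pi fun i => cond (volume : Measure ℝ)
    (Set.Icc (φ i - r) (φ i + r))) (φ := Function.eval i) h.measurable.aemeasurable
    (f := fun x => f (x - φ i)) (by fun_prop)
  rw [h.map_eq] at h2
  simp only [Function.eval] at h2
  rw [← h2, ProbabilityTheory.cond, integral_smul_measure, Real.volume_Icc, integral_Icc_eq_integral_Ioc,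
    ← intervalIntegral.integral_of_le (by linarith),
    intervalIntegral.integral_comp_sub_right (fun x => f x)]
  have h3 : φ i + r - (φ i - r) = 2 * r := by ring
  rw [h3, ENNReal.toReal_inv, ENNReal.toReal_ofReal (by linarith), smul_eq_mul]
  congr 2 <;> ring

/-- Under the uniform distribution, a function of one coordinate is independent of a function
that ignores this coordinate. -/
theorem integral_coord_mul_update {M : ℕ} (φ : Fin M → ℝ) {r : ℝ} (hr : 0 < r) (i : Fin M)
    (c : ℝ) {f : ℝ → ℝ} (hf : Continuous f) {g : (Fin M → ℝ) → ℝ} (hg : Continuous g) :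
    ∫ θ, f (θ i - φ i) * g (Function.update θ i c) ∂uniformCube φ r =
      (∫ θ, f (θ i - φ i) ∂uniformCube φ r) *
        ∫ θ, g (Function.update θ i c) ∂uniformCube φ r := by
  have := fun i => isProbabilityMeasure_cond_Icc (φ i) hr
  rw [uniformCube_eq_pi φ hr]
  have h : iIndepFun (fun (j : Fin M) (θ : Fin M → ℝ) => θ j) (Measure.pi fun i =>
    cond (volume : Measure ℝ) (Set.Icc (φ i - r) (φ i + r))) :=
    iIndepFun_pi (X := fun _ x => x) fun _ => aemeasurable_id
  have h1 := h.indepFun_finset {i} {i}ᶜ disjoint_compl_right fun j => measurable_pi_apply j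
  have hf' : Measurable fun x : (({i} : Finset (Fin M)) → ℝ) => f (x ⟨i, by simp⟩ - φ i) := by
    fun_prop
  have hg' : Measurable fun x : (({i}ᶜ : Finset (Fin M)) → ℝ) =>
      g fun j => if hj : j = i then c else x ⟨j, by simpa using hj⟩ := by
    refine hg.measurable.comp (measurable_pi_lambda _ fun j => ?_)
    by_cases hj : j = i
    · simp [hj]
    · simp only [hj, dite_false]
      fun_prop
  have h2 := h1.comp hf' hg'
  have h3 : (fun θ : Fin M → ℝ => g (Function.update θ i c)) =
      (fun x : (({i}ᶜ : Finset (Fin M)) → ℝ) =>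
        g fun j => if hj : j = i then c else x ⟨j, by simpa using hj⟩) ∘
        (fun θ (j : ({i}ᶜ : Finset (Fin M))) => θ j) := by
    ext θ
    simp only [Function.comp]
    congr 1
    ext j
    by_cases hj : j = i <;> simp [Function.update, hj]
  rw [← h3] at h2
  refine h2.integral_fun_mul_eq_mul_integral ?_ ?_
  · exact (by fun_prop : Continuous _).aestronglyMeasurable
  · have : Continuous fun θ : Fin M → ℝ => g (Function.update θ i c) := by fun_prop
    exact this.aestronglyMeasurable

/-- Continuous functions are in every `Lᵖ` space of the uniform distribution, because the cube is
compact. -/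
theorem memLp_uniformCube {M : ℕ} (φ : Fin M → ℝ) {r : ℝ} (hr : 0 < r)
    {g : (Fin M → ℝ) → ℝ} (hg : Continuous g) (p : ENNReal) : MemLp g p (uniformCube φ r) := by
  have := isProbabilityMeasure_uniformCube φ hr
  have hK : IsCompact (hypercube φ r) := by
    rw [hypercube_eq_pi]; exact isCompact_univ_pi fun i => isCompact_Icc
  obtain ⟨C, hC⟩ := hK.exists_bound_of_continuousOn hg.continuousOn
  refine MemLp.of_bound hg.aestronglyMeasurable C ?_
  filter_upwards [ae_cond_mem hK.measurableSet] with θ hθ using hC θ hθ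

theorem integrable_uniformCube {M : ℕ} (φ : Fin M → ℝ) {r : ℝ} (hr : 0 < r)
    {g : (Fin M → ℝ) → ℝ} (hg : Continuous g) : Integrable g (uniformCube φ r) :=
  memLp_one_iff_integrable.1 (memLp_uniformCube φ hr hg 1)

theorem intervalIntegral_eq_zero_of_odd {f : ℝ → ℝ} (hf : ∀ t, f (-t) = -f t) (r : ℝ) :
    ∫ t in -r..r, f t = 0 := by
  have h := intervalIntegral.integral_comp_neg (a := -r) (b := r) f
  simp only [hf, intervalIntegral.integral_neg, neg_neg] at h
  linarith

/-! ### Averages over a symmetric interval -/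

/-- The average of `cos²` over `[-r, r]`. -/
noncomputable def meanCosSq (r : ℝ) : ℝ := (2 * r)⁻¹ * ∫ t in -r..r, Real.cos t ^ 2

theorem meanCosSq_ge {r : ℝ} (hr : 0 < r) : 1 - r ^ 2 / 3 ≤ meanCosSq r := by
  have h : ∫ t in -r..r, (1 - t ^ 2) ≤ ∫ t in -r..r, Real.cos t ^ 2 := by
    refine intervalIntegral.integral_mono_on (by linarith)
      ((by fun_prop : Continuous _).intervalIntegrable _ _)
      ((by fun_prop : Continuous _).intervalIntegrable _ _) fun t _ => ?_
    nlinarith [Real.sin_sq_le_sq (x := t), Real.sin_sq_add_cos_sq t]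
  have h2 : ∫ t in -r..r, (1 - t ^ 2) = 2 * r * (1 - r ^ 2 / 3) := by
    rw [intervalIntegral.integral_sub (by simp) ((by fun_prop : Continuous _).intervalIntegrable _ _),
      integral_pow, intervalIntegral.integral_const]
    simp; ring
  rw [h2] at h
  rw [meanCosSq, inv_mul_eq_div, le_div_iff₀ (by linarith)]
  linarith

theorem meanCosSq_nonneg {r : ℝ} (hr : 0 < r) : 0 ≤ meanCosSq r :=
  mul_nonneg (by positivity)
    (intervalIntegral.integral_nonneg (by linarith) fun t _ => sq_nonneg _)

/-- The variance of `cos (2 t)` for `t` uniformly distributed in `[-r, r]`. -/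
noncomputable def varCosTwo (r : ℝ) : ℝ :=
  ((2 * r)⁻¹ * ∫ t in -r..r, Real.cos (2 * t) ^ 2) -
    ((2 * r)⁻¹ * ∫ t in -r..r, Real.cos (2 * t)) ^ 2

theorem varCosTwo_ge {r : ℝ} (hr : 0 < r) :
    16 * r ^ 4 / 45 * (1 - 4 * r ^ 2 / 7) ≤ varCosTwo r := by
  have h1 : ∫ t in -r..r, Real.cos (2 * t) = Real.sin (2 * r) := by
    rw [intervalIntegral.integral_comp_mul_left (fun x => Real.cos x) two_ne_zero, integral_cos]
    simp; ring
  have h2 : ∫ t in -r..r, Real.cos (2 * t) ^ 2 = r + Real.sin (2 * r) * Real.cos (2 * r) / 2 := by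
    rw [intervalIntegral.integral_comp_mul_left (fun x => Real.cos x ^ 2) two_ne_zero,
      integral_cos_sq]
    simp; ring
  have h := cos_variance_taylor (x := 2 * (2 * r)) (by linarith)
  rw [Real.sin_two_mul (2 * r), Real.cos_two_mul (2 * r), Real.cos_sq' (2 * r)] at h
  have key : varCosTwo r - 16 * r ^ 4 / 45 * (1 - 4 * r ^ 2 / 7) = (16 * r ^ 2)⁻¹ *
      ((2 * (2 * r)) ^ 2 / 2 + 2 * (2 * r) * (2 * Real.sin (2 * r) * Real.cos (2 * r)) / 2 -
        2 * (1 - (2 * (1 - Real.sin (2 * r) ^ 2) - 1)) -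
        (2 * (2 * r)) ^ 6 / 720 + (2 * (2 * r)) ^ 8 / 20160) := by
    rw [varCosTwo, h1, h2]
    field_simp
    ring
  have := mul_nonneg (by positivity : 0 ≤ (16 * r ^ 2)⁻¹) h
  linarith

/-! ### Functions that are trigonometric in each coordinate -/

/-- A continuous function that is, in each coordinate separately, a trigonometric polynomial
`α + β cos (2 t) + γ sin (2 t)`. The coefficients are expressed by the values at `c`, `c + π / 4`
and `c + π / 2`. -/
structure IsTrig {M : ℕ} (F : (Fin M → ℝ) → ℝ) : Prop where
  continuous : Continuous F
  update_add : ∀ (φ : Fin M → ℝ) (i : Fin M) (c t : ℝ),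
    F (Function.update φ i (c + t)) =
      Real.cos t ^ 2 * F (Function.update φ i c) +
      Real.sin t ^ 2 * F (Function.update φ i (c + Real.pi / 2)) +
      Real.sin t * Real.cos t * (2 * F (Function.update φ i (c + Real.pi / 4)) -
        F (Function.update φ i c) - F (Function.update φ i (c + Real.pi / 2)))

namespace IsTrig

variable {M : ℕ} {F G : (Fin M → ℝ) → ℝ}

theorem const (a : ℝ) : IsTrig fun _ : Fin M → ℝ => a where
  continuous := continuous_const
  update_add φ i c t := by linear_combination (-a) * Real.sin_sq_add_cos_sq t

theorem add (hF : IsTrig F) (hG : IsTrig G) : IsTrig fun φ => F φ + G φ where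
  continuous := hF.continuous.add hG.continuous
  update_add φ i c t := by rw [hF.update_add, hG.update_add]; ring

theorem const_mul (a : ℝ) (hF : IsTrig F) : IsTrig fun φ => a * F φ where
  continuous := hF.continuous.const_mul a
  update_add φ i c t := by rw [hF.update_add]; ring

theorem sub (hF : IsTrig F) (hG : IsTrig G) : IsTrig fun φ => F φ - G φ where
  continuous := hF.continuous.sub hG.continuous
  update_add φ i c t := by rw [hF.update_add, hG.update_add]; ring

theorem sum {κ : Type*} (s : Finset κ) {F : κ → (Fin M → ℝ) → ℝ} (hF : ∀ j ∈ s, IsTrig (F j)) :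
    IsTrig fun φ => ∑ j ∈ s, F j φ where
  continuous := continuous_finsetSum _ fun j hj => (hF j hj).continuous
  update_add φ i c t := by
    rw [Finset.sum_congr rfl fun j hj => (hF j hj).update_add φ i c t]
    simp only [Finset.sum_add_distrib, Finset.sum_sub_distrib, Finset.mul_sum, mul_sub]

theorem comp_update (hF : IsTrig F) (i : Fin M) (c : ℝ) :
    IsTrig fun φ => F (Function.update φ i c) where
  continuous := hF.continuous.comp (by fun_prop)
  update_add φ j d t := by
    by_cases h : j = i
    · subst h
      simp only [Function.update_idem]
      linear_combination (-F (Function.update φ j c)) * Real.sin_sq_add_cos_sq t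
    · simp only [Function.update_comm h]
      exact hF.update_add _ _ _ _

/-- Averaging one coordinate of a nonnegative trigonometric polynomial over a symmetric interval
costs at most the factor `meanCosSq r` relative to fixing it at the centre. -/
theorem integral_ge_update (hF : IsTrig F) (hF0 : ∀ φ, 0 ≤ F φ) (φ : Fin M → ℝ) {r : ℝ}
    (hr : 0 < r) (i : Fin M) :
    meanCosSq r * ∫ θ, F (Function.update θ i (φ i)) ∂uniformCube φ r ≤
      ∫ θ, F θ ∂uniformCube φ r := by
  have h1 : ∀ θ, F θ =
      Real.cos (θ i - φ i) ^ 2 * F (Function.update θ i (φ i)) +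
      Real.sin (θ i - φ i) ^ 2 * F (Function.update θ i (φ i + Real.pi / 2)) +
      Real.sin (θ i - φ i) * Real.cos (θ i - φ i) *
        (2 * F (Function.update θ i (φ i + Real.pi / 4)) -
          F (Function.update θ i (φ i)) - F (Function.update θ i (φ i + Real.pi / 2))) :=
    fun θ => by rw [← hF.update_add]; simp
  have hFc := hF.continuous
  have hodd : ∫ θ, Real.sin (θ i - φ i) * Real.cos (θ i - φ i) *
      (2 * F (Function.update θ i (φ i + Real.pi / 4)) -
        F (Function.update θ i (φ i)) - F (Function.update θ i (φ i + Real.pi / 2)))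
        ∂uniformCube φ r = 0 := by
    have h := integral_coord_mul_update φ hr i (φ i) (f := fun t => Real.sin t * Real.cos t)
      (by fun_prop) (g := fun θ => 2 * F (Function.update θ i (φ i + Real.pi / 4)) -
        F (Function.update θ i (φ i)) - F (Function.update θ i (φ i + Real.pi / 2)))
        (by fun_prop)
    simp only [Function.update_idem] at h
    rw [h, integral_uniformCube_coord φ hr i (f := fun t => Real.sin t * Real.cos t)
      (by fun_prop), intervalIntegral_eq_zero_of_odd (by simp)]
    simp
  have hcos := integral_coord_mul_update φ hr i (φ i) (f := fun t => Real.cos t ^ 2)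
    (by fun_prop) hF.continuous
  rw [integral_uniformCube_coord φ hr i (f := fun t => Real.cos t ^ 2) (by fun_prop)] at hcos
  have hsin : 0 ≤ ∫ θ, Real.sin (θ i - φ i) ^ 2 *
      F (Function.update θ i (φ i + Real.pi / 2)) ∂uniformCube φ r :=
    integral_nonneg fun θ => mul_nonneg (sq_nonneg _) (hF0 _)
  rw [integral_congr_ae (Filter.Eventually.of_forall h1), integral_add, integral_add, hodd, hcos,
    meanCosSq]
  · linarith
  all_goals exact integrable_uniformCube φ hr (by fun_prop)

/-- Here `s.piecewise φ θ` resets the coordinates in `s` to the centre `φ`. -/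
theorem integral_ge_piecewise (hF : IsTrig F) (hF0 : ∀ φ, 0 ≤ F φ) (φ : Fin M → ℝ) {r : ℝ}
    (hr : 0 < r) (s : Finset (Fin M)) :
    meanCosSq r ^ s.card * ∫ θ, F (s.piecewise φ θ) ∂uniformCube φ r ≤
      ∫ θ, F θ ∂uniformCube φ r := by
  induction s using Finset.induction_on generalizing F with
  | empty => simp
  | insert i s hi ih =>
    refine le_trans ?_ (hF.integral_ge_update hF0 φ hr i)
    rw [Finset.card_insert_of_notMem hi, pow_succ', mul_assoc]
    simp only [Finset.piecewise_insert]
    exact mul_le_mul_of_nonneg_left (ih (hF.comp_update i (φ i)) fun _ => hF0 _)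
      (meanCosSq_nonneg hr)

/-- If `F` does not depend on coordinate `i`, its mean over the cube is bounded below by its value
at the centre, with a loss that is linear in the number of remaining coordinates. -/
theorem integral_ge_center (hF : IsTrig F) (hF0 : ∀ φ, 0 ≤ F φ) (φ : Fin M → ℝ) {r : ℝ}
    (hr : 0 < r) (i : Fin M) (hi : ∀ θ c, F (Function.update θ i c) = F θ) :
    (1 - (M - 1 : ℝ) * (r ^ 2 / 3)) * F φ ≤ ∫ θ, F θ ∂uniformCube φ r := by
  have := isProbabilityMeasure_uniformCube φ hr
  have h := hF.integral_ge_piecewise hF0 φ hr (Finset.univ.erase i)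
  have h1 : ∀ θ, F ((Finset.univ.erase i).piecewise φ θ) = F φ := fun θ => by
    rw [← hi _ (φ i), ← Finset.piecewise_insert, Finset.insert_erase (Finset.mem_univ i),
      Finset.piecewise_univ]
  simp only [h1, integral_const, probReal_univ, one_smul] at h
  have hM : 1 ≤ M := Fin.pos i
  rw [Finset.card_erase_of_mem (Finset.mem_univ i), Finset.card_univ, Fintype.card_fin] at h
  refine le_trans (mul_le_mul_of_nonneg_right ?_ (hF0 φ)) h
  have hb := one_add_mul_le_pow (a := meanCosSq r - 1) (by linarith [meanCosSq_nonneg hr]) (M - 1)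
  rw [Nat.cast_sub hM, Nat.cast_one, add_sub_cancel] at hb
  refine le_trans ?_ hb
  have : (1 : ℝ) ≤ M := by exact_mod_cast hM
  nlinarith [meanCosSq_ge hr]

/-- The variance is at least the part explained by the component along `cos (2 (θᵢ - φᵢ))`. -/
theorem variance_ge (hF : IsTrig F) (φ : Fin M → ℝ) {r : ℝ} (hr : 0 < r) (i : Fin M) :
    varCosTwo r * ((∫ θ, (F (Function.update θ i (φ i)) -
      F (Function.update θ i (φ i + Real.pi / 2))) ∂uniformCube φ r) / 2) ^ 2 ≤
      variance F (uniformCube φ r) := by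
  have := isProbabilityMeasure_uniformCube φ hr
  set μ := uniformCube φ r with hμ
  set B := (∫ θ, (F (Function.update θ i (φ i)) -
      F (Function.update θ i (φ i + Real.pi / 2))) ∂μ) / 2 with hB
  set m := (2 * r)⁻¹ * ∫ t in -r..r, Real.cos (2 * t) with hm
  let h : (Fin M → ℝ) → ℝ := fun θ => Real.cos (2 * (θ i - φ i))
  have hcont : Continuous h := by fun_prop
  have hmean : ∫ θ, h θ ∂μ = m :=
    integral_uniformCube_coord φ hr i (f := fun t => Real.cos (2 * t)) (by fun_prop)
  have hmean2 : ∫ θ, h θ ^ 2 ∂μ = (2 * r)⁻¹ * ∫ t in -r..r, Real.cos (2 * t) ^ 2 :=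
    integral_uniformCube_coord φ hr i (f := fun t => Real.cos (2 * t) ^ 2) (by fun_prop)
  have hvar : variance h μ = varCosTwo r := by
    rw [variance_eq_sub (memLp_uniformCube φ hr hcont 2), hmean, varCosTwo, ← hmean2]
    rfl
  have hFc := hF.continuous
  let α : (Fin M → ℝ) → ℝ := fun θ =>
    (F (Function.update θ i (φ i)) + F (Function.update θ i (φ i + Real.pi / 2))) / 2
  let β : (Fin M → ℝ) → ℝ := fun θ =>
    F (Function.update θ i (φ i)) - F (Function.update θ i (φ i + Real.pi / 2))
  let γ : (Fin M → ℝ) → ℝ := fun θ => 2 * F (Function.update θ i (φ i + Real.pi / 4)) -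
          F (Function.update θ i (φ i)) - F (Function.update θ i (φ i + Real.pi / 2))
  have hα : Continuous α := by simp only [α]; fun_prop
  have hβ : Continuous β := by simp only [β]; fun_prop
  have hγ : Continuous γ := by simp only [γ]; fun_prop
  -- Only the component along `h` survives in the covariance: the constant term is uncorrelated
  -- with `h` and the sine term is odd.
  have hexp : ∀ θ, F θ * (h θ - m) =
      (h θ - m) * α θ + (h θ / 2 * (h θ - m)) * β θ +
        (Real.sin (θ i - φ i) * Real.cos (θ i - φ i) * (h θ - m)) * γ θ := fun θ => by
    have h1 : F θ = F (Function.update θ i (φ i + (θ i - φ i))) := by simp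
    rw [h1, hF.update_add]
    simp only [h, α, β, γ, Real.cos_two_mul]
    linear_combination (2 * Real.cos (θ i - φ i) ^ 2 - 1 - m) *
      F (Function.update θ i (φ i + Real.pi / 2)) * Real.sin_sq_add_cos_sq (θ i - φ i)
  have hI := fun (f : ℝ → ℝ) (hf : Continuous f) (g : (Fin M → ℝ) → ℝ) (hg : Continuous g)
      (hg' : ∀ θ, g (Function.update θ i (φ i)) = g θ) =>
    show ∫ θ, f (θ i - φ i) * g θ ∂μ = (∫ θ, f (θ i - φ i) ∂μ) * ∫ θ, g θ ∂μ by
      simpa only [hg'] using integral_coord_mul_update φ hr i (φ i) hf hg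
  have hIα : ∫ θ, (h θ - m) * α θ ∂μ = 0 := by
    rw [hI (fun t => Real.cos (2 * t) - m) (by fun_prop) α hα (by simp [α])]
    have : ∫ θ, (h θ - m) ∂μ = 0 := by
      rw [integral_sub (integrable_uniformCube φ hr hcont) (integrable_const _), hmean]
      simp
    simp only [h] at this
    rw [this, zero_mul]
  have hIβ : ∫ θ, (h θ / 2 * (h θ - m)) * β θ ∂μ = varCosTwo r * B := by
    rw [hI (fun t => Real.cos (2 * t) / 2 * (Real.cos (2 * t) - m)) (by fun_prop) β hβ
      (by simp [β])]
    have : ∫ θ, h θ / 2 * (h θ - m) ∂μ = varCosTwo r / 2 := by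
      have h2 : ∀ θ, h θ / 2 * (h θ - m) = (1 / 2) * (h θ ^ 2) - m / 2 * h θ := fun θ => by ring
      simp only [h2]
      rw [integral_sub, integral_const_mul, integral_const_mul, hmean, hmean2, varCosTwo]
      · ring
      all_goals exact integrable_uniformCube φ hr (by fun_prop)
    simp only [h] at this
    rw [this, hB]
    ring
  have hIγ : ∫ θ, (Real.sin (θ i - φ i) * Real.cos (θ i - φ i) * (h θ - m)) * γ θ ∂μ = 0 := by
    rw [hI (fun t => Real.sin t * Real.cos t * (Real.cos (2 * t) - m)) (by fun_prop) γ hγ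
      (by simp [γ]), integral_uniformCube_coord φ hr i
        (f := fun t => Real.sin t * Real.cos t * (Real.cos (2 * t) - m)) (by fun_prop),
      intervalIntegral_eq_zero_of_odd (by simp)]
    simp
  have hcov : covariance F h μ = varCosTwo r * B := by
    have h1 : ∫ θ, F θ * (h θ - m) ∂μ = varCosTwo r * B := by
      simp only [hexp]
      rw [integral_add, integral_add, hIα, hIβ, hIγ]
      · ring
      all_goals exact integrable_uniformCube φ hr (by fun_prop)
    rw [covariance_eq_sub (memLp_uniformCube φ hr hFc 2) (memLp_uniformCube φ hr hcont 2),
      ← h1, hmean]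
    simp only [mul_sub, Pi.mul_apply]
    rw [integral_sub, integral_mul_const]
    all_goals exact integrable_uniformCube φ hr (by fun_prop)
  -- The variance of `F - B h` is nonnegative.
  have hpos := variance_nonneg (F - fun θ => B * h θ) μ
  rw [variance_sub (memLp_uniformCube φ hr hFc 2)
    (memLp_uniformCube φ hr (by fun_prop) 2), covariance_const_mul_right, hcov,
    variance_const_mul, hvar] at hpos
  linarith

/-- If all values lie in `[0, 1]` and moving coordinate `i` of the centre by `π / 2` lowers the
value by at least `D`, then the variance over the cube is bounded below. -/
theorem variance_ge_of_gap (hF : IsTrig F) (hF0 : ∀ φ, 0 ≤ F φ) (hF1 : ∀ φ, F φ ≤ 1)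
    (φ : Fin M → ℝ) {r r₀ D : ℝ} (hr : 0 < r) (hr₀ : r₀ ^ 2 ≤ 1) (i : Fin M) (hD : 0 ≤ D)
    (hgap : D ≤ F φ - F (Function.update φ i (φ i + Real.pi / 2)))
    (hB : ((M : ℝ) - 1) * r ^ 2 ≤ 3 * r₀ ^ 2 * (D / (1 + D))) :
    4 * r ^ 4 / 45 * (1 - 4 * r ^ 2 / 7) * (1 - r₀ ^ 2) ^ 2 * D ^ 2 ≤
      variance F (uniformCube φ r) := by
  have := isProbabilityMeasure_uniformCube φ hr
  -- For large `r` the claimed bound is not positive.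
  rcases le_or_gt (1 - 4 * r ^ 2 / 7) 0 with hneg | hpos
  · refine le_trans ?_ (variance_nonneg _ _)
    have : 0 ≤ r ^ 4 * ((1 - r₀ ^ 2) ^ 2 * D ^ 2) := by positivity
    nlinarith
  -- Adding `1` makes the difference of the two values nonnegative.
  have hdiff := (hF.comp_update i (φ i)).sub (hF.comp_update i (φ i + Real.pi / 2))
  have h1 := ((IsTrig.const 1).add hdiff).integral_ge_center
    (fun θ => by
      have := hF0 (Function.update θ i (φ i))
      have := hF1 (Function.update θ i (φ i + Real.pi / 2))
      linarith) φ hr i (by simp)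
  rw [integral_add (integrable_const _) (integrable_uniformCube φ hr hdiff.continuous)] at h1
  simp only [integral_const, probReal_univ, one_smul, Function.update_eq_self] at h1
  set I := ∫ θ, (F (Function.update θ i (φ i)) -
      F (Function.update θ i (φ i + Real.pi / 2))) ∂uniformCube φ r
  have hq : 1 - r₀ ^ 2 * (D / (1 + D)) ≤ 1 - (M - 1 : ℝ) * (r ^ 2 / 3) := by linarith
  have hDD : D / (1 + D) ≤ 1 := (div_le_one (by linarith)).2 (by linarith)
  have hDD0 : 0 ≤ D / (1 + D) := by positivity
  have hq0 : 0 ≤ 1 - r₀ ^ 2 * (D / (1 + D)) := by nlinarith [sq_nonneg r₀]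
  have hI : (1 - r₀ ^ 2) * D ≤ I := by
    have h2 : (1 - r₀ ^ 2 * (D / (1 + D))) * (1 + D) = 1 + (1 - r₀ ^ 2) * D := by
      field_simp; ring
    have h3 := mul_le_mul hq (by linarith [hgap] : 1 + D ≤ 1 + (F φ -
      F (Function.update φ i (φ i + Real.pi / 2)))) (by linarith) (hq0.trans hq)
    linarith
  refine le_trans ?_ (hF.variance_ge φ hr i)
  have hI0 : 0 ≤ (1 - r₀ ^ 2) * D := mul_nonneg (by linarith) hD
  have h4 : (((1 - r₀ ^ 2) * D) / 2) ^ 2 ≤ (I / 2) ^ 2 := by gcongr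
  calc _ = 16 * r ^ 4 / 45 * (1 - 4 * r ^ 2 / 7) * (((1 - r₀ ^ 2) * D) / 2) ^ 2 := by ring
    _ ≤ varCosTwo r * (I / 2) ^ 2 :=
      mul_le_mul (varCosTwo_ge hr) h4 (sq_nonneg _)
        (le_trans (by positivity) (varCosTwo_ge hr))

end IsTrig

/-! ### Matrices as operators -/

/-- The continuous linear operator on the Hilbert space given by a matrix. -/
noncomputable abbrev opCLM {n : ℕ} (A : Op n) : Ket n →L[ℂ] Ket n :=
  Matrix.toEuclideanCLM (n := Bits n) (𝕜 := ℂ) A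

theorem braket_eq_inner {n : ℕ} (φ : Ket n) (A : Op n) (ψ : Ket n) :
    braket φ A ψ = inner ℂ φ (opCLM A ψ) := by
  rw [EuclideanSpace.inner_eq_star_dotProduct, dotProduct_comm]
  rfl

theorem braket_conjTranspose_mul {n : ℕ} (φ : Ket n) (A B : Op n) (ψ : Ket n) :
    braket φ (Aᴴ * B) ψ = inner ℂ (opCLM A φ) (opCLM B ψ) := by
  rw [braket_eq_inner, opCLM, map_mul, ← Matrix.star_eq_conjTranspose, map_star,
    ContinuousLinearMap.star_eq_adjoint, mul_apply_eq_comp,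
    ContinuousLinearMap.adjoint_inner_right]

theorem norm_opCLM_of_mem_unitaryGroup {n : ℕ} {A : Op n}
    (hA : A ∈ Matrix.unitaryGroup (Bits n) ℂ) (ψ : Ket n) : ‖opCLM A ψ‖ = ‖ψ‖ := by
  have h : inner ℂ (opCLM A ψ) (opCLM A ψ) = inner ℂ ψ ψ := by
    rw [← braket_conjTranspose_mul, ← Matrix.star_eq_conjTranspose,
      Matrix.mem_unitaryGroup_iff'.1 hA, braket_eq_inner]
    simp
  rw [inner_self_eq_norm_sq_to_K, inner_self_eq_norm_sq_to_K] at h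
  exact (sq_eq_sq₀ (norm_nonneg _) (norm_nonneg _)).1 (by exact_mod_cast h)

theorem norm_braket_conjTranspose_mul_le {n : ℕ} {A B : Op n}
    (hA : A ∈ Matrix.unitaryGroup (Bits n) ℂ) (hB : B ∈ Matrix.unitaryGroup (Bits n) ℂ)
    {φ ψ : Ket n} (hφ : ‖φ‖ = 1) (hψ : ‖ψ‖ = 1) : ‖braket φ (Aᴴ * B) ψ‖ ≤ 1 := by
  rw [braket_conjTranspose_mul]
  refine (norm_inner_le_norm _ _).trans ?_
  rw [norm_opCLM_of_mem_unitaryGroup hA, norm_opCLM_of_mem_unitaryGroup hB, hφ, hψ, one_mul]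

/-! ### Pauli strings -/

theorem Pauli.toMatrix_isHermitian (P : Pauli) : P.toMatrix.IsHermitian := by
  cases P <;> ext i j <;> fin_cases i <;> fin_cases j <;> simp [Pauli.toMatrix]

theorem Pauli.toMatrix_mul_self (P : Pauli) : P.toMatrix * P.toMatrix = 1 := by
  cases P <;> ext i j <;> fin_cases i <;> fin_cases j <;> simp [Pauli.toMatrix]

theorem pauliString_isHermitian {n : ℕ} (P : Fin n → Pauli) : (pauliString P).IsHermitian := by
  ext x y
  simp only [pauliString, Matrix.conjTranspose_apply, Matrix.of_apply, star_prod]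
  exact Finset.prod_congr rfl fun k _ => (P k).toMatrix_isHermitian.apply _ _

theorem pauliString_mul_self {n : ℕ} (P : Fin n → Pauli) :
    pauliString P * pauliString P = 1 := by
  ext x y
  have h := Finset.prod_univ_sum (fun _ : Fin n => (Finset.univ : Finset (Fin 2)))
    fun k b => (P k).toMatrix (x k) b * (P k).toMatrix b (y k)
  simp only [Fintype.piFinset_univ, ← Matrix.mul_apply, Pauli.toMatrix_mul_self,
    Finset.prod_mul_distrib] at h
  simp only [Matrix.mul_apply, pauliString, Matrix.of_apply, ← h]
  simp only [Matrix.one_apply, Finset.prod_ite_zero, funext_iff]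
  simp

theorem pauliString_mem_unitaryGroup {n : ℕ} (P : Fin n → Pauli) :
    pauliString P ∈ Matrix.unitaryGroup (Bits n) ℂ := by
  rw [Matrix.mem_unitaryGroup_iff, Matrix.star_eq_conjTranspose, (pauliString_isHermitian P).eq,
    pauliString_mul_self]

open scoped Matrix.Norms.L2Operator in
/-- Euler's formula for an involution: the exponential is transported from `ℂ × ℂ` along the
algebra homomorphism sending `(1, -1)` to `A`. -/
theorem exp_smul_of_mul_self_eq_one {n : ℕ} {A : Op n} (hA : A * A = 1) (z : ℂ) :
    NormedSpace.exp (z • A) = Complex.cosh z • (1 : Op n) + Complex.sinh z • A := by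
  let f : ℂ × ℂ →+* Op n :=
    { toFun := fun u => ((u.1 + u.2) / 2) • (1 : Op n) + ((u.1 - u.2) / 2) • A
      map_one' := by simp
      map_zero' := by simp
      map_add' := fun u v => by
        simp only [Prod.fst_add, Prod.snd_add]
        module
      map_mul' := fun u v => by
        simp only [add_mul, mul_add, smul_mul_smul_comm, hA, one_mul, mul_one, Prod.fst_mul,
          Prod.snd_mul]
        module }
  have hf : Continuous f := by
    change Continuous fun u : ℂ × ℂ =>
      ((u.1 + u.2) / 2) • (1 : Op n) + ((u.1 - u.2) / 2) • A
    fun_prop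
  have h := NormedSpace.map_exp f hf (z, -z)
  have h1 : f (z, -z) = z • A := by
    change ((z + -z) / 2) • (1 : Op n) + ((z - -z) / 2) • A = z • A
    module
  rw [← h1, ← h]
  change (((NormedSpace.exp (z, -z)).1 + (NormedSpace.exp (z, -z)).2) / 2) • (1 : Op n) +
    (((NormedSpace.exp (z, -z)).1 - (NormedSpace.exp (z, -z)).2) / 2) • A = _
  rw [Prod.fst_exp, Prod.snd_exp, ← Complex.exp_eq_exp_ℂ]
  rfl

/-! ### Unitary evolution -/

theorem exp_mem_unitaryGroup {n : ℕ} {A : Op n} (hA : A.IsHermitian) (t : ℝ) :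
    NormedSpace.exp ((-(Complex.I * (t : ℂ))) • A) ∈ Matrix.unitaryGroup (Bits n) ℂ := by
  rw [Matrix.mem_unitaryGroup_iff, Matrix.star_eq_conjTranspose, ← Matrix.exp_conjTranspose]
  have h : ((-(Complex.I * (t : ℂ))) • A)ᴴ = -((-(Complex.I * (t : ℂ))) • A) := by
    rw [Matrix.conjTranspose_smul, hA.eq, ← neg_smul]
    simp
  rw [h, Matrix.exp_neg, Matrix.mul_nonsing_inv]
  exact (Matrix.isUnit_iff_isUnit_det _).1 (Matrix.isUnit_exp _)

open scoped Matrix.Norms.L2Operator in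
/-- Over time `t`, a Hamiltonian moves a state by at most `|E_m| t`. -/
theorem norm_evolution_sub_le {n M : ℕ} (S : Model n M) {t : ℝ} (ht : 0 ≤ t) (ψ : Ket n) :
    ‖opCLM (S.evolution t) ψ - ψ‖ ≤ S.maxAbsEnergy * t * ‖ψ‖ := by
  set U : Op n := (S.isHermitian.eigenvectorUnitary : Op n) with hU
  have hUm : U ∈ Matrix.unitaryGroup (Bits n) ℂ := S.isHermitian.eigenvectorUnitary.2
  have hUU : U * Uᴴ = 1 := Matrix.mem_unitaryGroup_iff.1 hUm
  have hUm' : Uᴴ ∈ Matrix.unitaryGroup (Bits n) ℂ := Unitary.star_mem hUm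
  have hinv : U⁻¹ = Uᴴ := Matrix.inv_eq_right_inv hUU
  have hunit : IsUnit U :=
    (Matrix.isUnit_iff_isUnit_det _).2 (Matrix.isUnit_det_of_right_inverse hUU)
  set E := S.isHermitian.eigenvalues
  have hH : S.H = U * Matrix.diagonal (fun i => (E i : ℂ)) * Uᴴ := S.isHermitian.spectral_theorem
  have hev : S.evolution t - 1 =
      U * Matrix.diagonal (fun i => Complex.exp (-(Complex.I * t) * E i) - 1) * Uᴴ := by
    have h1 : (-(Complex.I * (t : ℂ))) • S.H =
        U * Matrix.diagonal (fun i => -(Complex.I * t) * (E i : ℂ)) * U⁻¹ := by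
      have h2 : Matrix.diagonal (fun i => -(Complex.I * t) * (E i : ℂ)) =
          (-(Complex.I * (t : ℂ))) • Matrix.diagonal (fun i => (E i : ℂ)) := by
        rw [← Matrix.diagonal_smul]; rfl
      rw [hinv, h2, hH, Matrix.mul_smul, Matrix.smul_mul]
    have h3 : Matrix.diagonal (fun i => Complex.exp (-(Complex.I * t) * E i) - 1) =
        Matrix.diagonal (fun i => Complex.exp (-(Complex.I * t) * E i)) - 1 := by
      rw [← Matrix.diagonal_one, Matrix.diagonal_sub]
    rw [Model.evolution, h1, Matrix.exp_conj _ _ hunit, Matrix.exp_diagonal, h3, mul_sub, sub_mul,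
      mul_one, hUU, hinv]
    congr 4
    ext i
    rw [Pi.coe_exp, Complex.exp_eq_exp_ℂ]
  have hD : ‖Matrix.diagonal (fun i => Complex.exp (-(Complex.I * t) * E i) - 1)‖ ≤
      S.maxAbsEnergy * t := by
    have hE : ∀ i, |E i| ≤ S.maxAbsEnergy := le_ciSup (Set.finite_range _).bddAbove
    rw [Matrix.l2_opNorm_diagonal, pi_norm_le_iff_of_nonneg
      (mul_nonneg ((abs_nonneg _).trans (hE fun _ => 0)) ht)]
    intro i
    have h4 : -(Complex.I * t) * E i = Complex.I * ((-(t * E i) : ℝ) : ℂ) := by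
      push_cast; ring
    rw [h4]
    refine Real.norm_exp_I_mul_ofReal_sub_one_le.trans ?_
    rw [norm_neg, norm_mul, Real.norm_of_nonneg ht, mul_comm]
    exact mul_le_mul_of_nonneg_right (hE i) ht
  have h5 : opCLM (S.evolution t) ψ - ψ = opCLM (S.evolution t - 1) ψ := by
    simp [opCLM]
  rw [h5, hev, opCLM, map_mul, map_mul, mul_apply_eq_comp,
    mul_apply_eq_comp]
  refine (norm_opCLM_of_mem_unitaryGroup hUm _).trans_le ?_
  refine (ContinuousLinearMap.le_opNorm _ _).trans ?_
  rw [Matrix.l2_opNorm_toEuclideanCLM, norm_opCLM_of_mem_unitaryGroup hUm']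
  exact mul_le_mul_of_nonneg_right hD (norm_nonneg _)

/-! ### The parametrized gates -/

namespace Model

variable {n M : ℕ} (S : Model n M)

theorem gate_eq (i : Fin M) (t : ℝ) :
    S.gate i t = (Real.cos t : ℂ) • (1 : Op n) - (Complex.I * (Real.sin t : ℂ)) • S.σ i := by
  rw [gate, exp_smul_of_mul_self_eq_one (A := S.σ i) (pauliString_mul_self _), mul_comm Complex.I,
    Complex.cosh_neg, Complex.sinh_neg, Complex.cosh_mul_I, Complex.sinh_mul_I,
    Complex.ofReal_cos, Complex.ofReal_sin, mul_comm Complex.I, neg_smul, sub_eq_add_neg]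

theorem gate_add (i : Fin M) (c t : ℝ) :
    S.gate i (c + t) = (Real.cos t : ℂ) • S.gate i c +
      (Real.sin t : ℂ) • S.gate i (c + Real.pi / 2) := by
  simp only [gate_eq, Real.cos_add, Real.sin_add, Real.cos_pi_div_two, Real.sin_pi_div_two]
  push_cast
  module

theorem gate_add_pi_div_two (i : Fin M) (c : ℝ) :
    S.gate i (c + Real.pi / 2) = S.gate i c * ((-Complex.I) • S.σ i) := by
  have hσ : S.σ i * S.σ i = 1 := pauliString_mul_self _
  simp only [gate_eq, Real.cos_add, Real.sin_add, Real.cos_pi_div_two, Real.sin_pi_div_two,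
    sub_mul, smul_mul_smul_comm, hσ, one_mul]
  push_cast
  match_scalars
  · linear_combination (-Complex.sin c : ℂ) * Complex.I_sq
  · ring

theorem gate_mem_unitaryGroup (i : Fin M) (t : ℝ) :
    S.gate i t ∈ Matrix.unitaryGroup (Bits n) ℂ :=
  exp_mem_unitaryGroup (pauliString_isHermitian _) t

theorem continuous_gate (i : Fin M) : Continuous (S.gate i) := by
  have h : S.gate i = fun t : ℝ => (Real.cos t : ℂ) • (1 : Op n) -
      (Complex.I * (Real.sin t : ℂ)) • S.σ i := funext (S.gate_eq i)
  rw [h]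
  fun_prop

/-! ### The circuit -/

/-- A product of a list depends on each factor through multiplication on both sides. -/
theorem _root_.List.exists_reverse_prod_ofFn_update {A : Type*} [Monoid A] {M : ℕ} (i : Fin M)
    (X : Fin M → A) :
    ∃ L R : A, ∀ y, (List.ofFn (Function.update X i y)).reverse.prod = L * y * R := by
  induction M with
  | zero => exact i.elim0
  | succ M ih =>
    refine Fin.cases ?_ (fun j => ?_) i
    · refine ⟨(List.ofFn fun k : Fin M => X k.succ).reverse.prod, 1, fun y => ?_⟩
      simp [List.ofFn_succ]
    · obtain ⟨L, R, h⟩ := ih j fun k => X k.succ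
      refine ⟨L, R * X 0, fun y => ?_⟩
      have h1 : (fun k : Fin M => Function.update X j.succ y k.succ) =
          Function.update (fun k => X k.succ) j y := by
        ext k
        by_cases hk : k = j <;> simp [Function.update, hk]
      have h2 : Function.update X j.succ y 0 = X 0 :=
        Function.update_of_ne (Fin.succ_ne_zero j).symm _ _
      rw [List.ofFn_succ, h1, List.reverse_cons, List.prod_append, h, h2]
      simp [mul_assoc]

theorem exists_circuit_update (φ : Fin M → ℝ) (i : Fin M) :
    ∃ L R : Op n, ∀ t, S.circuit (Function.update φ i t) = L * S.gate i t * R := by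
  obtain ⟨L, R, h⟩ := List.exists_reverse_prod_ofFn_update i
    fun k => (S.W k : Op n) * S.gate k (φ k)
  refine ⟨L * S.W i, R, fun t => ?_⟩
  rw [mul_assoc L, ← h, circuit]
  congr 3
  ext1 k
  by_cases hk : k = i
  · subst hk; simp
  · simp [hk]

theorem circuit_update_add (φ : Fin M → ℝ) (i : Fin M) (c t : ℝ) :
    S.circuit (Function.update φ i (c + t)) =
      (Real.cos t : ℂ) • S.circuit (Function.update φ i c) +
      (Real.sin t : ℂ) • S.circuit (Function.update φ i (c + Real.pi / 2)) := by
  obtain ⟨L, R, h⟩ := S.exists_circuit_update φ i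
  simp only [h, S.gate_add i c t, mul_add, add_mul, Matrix.mul_smul, Matrix.smul_mul]

theorem circuit_mem_unitaryGroup (φ : Fin M → ℝ) :
    S.circuit φ ∈ Matrix.unitaryGroup (Bits n) ℂ := by
  refine Submonoid.list_prod_mem _ fun A hA => ?_
  rw [List.mem_reverse, List.mem_ofFn] at hA
  obtain ⟨i, rfl⟩ := hA
  exact mul_mem (S.W i).2 (S.gate_mem_unitaryGroup i _)

theorem continuous_circuit : Continuous S.circuit := by
  unfold circuit
  have h : (fun φ : Fin M → ℝ =>
      (List.ofFn fun i : Fin M => (S.W i : Op n) * S.gate i (φ i)).reverse.prod) =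
      fun φ => ((List.ofFn fun i : Fin M => i).reverse.map
        fun i => (S.W i : Op n) * S.gate i (φ i)).prod := by
    ext1 φ
    rw [List.map_reverse, List.map_ofFn]
    rfl
  rw [h]
  refine continuous_list_prod _ fun i _ => ?_
  exact continuous_const.mul ((S.continuous_gate i).comp (continuous_apply i))

/-- Shifting the parameter of the first gate by `π / 2` multiplies the input state by `-i σ₁`. -/
theorem circuit_update_zero [NeZero M] (φ : Fin M → ℝ) :
    S.circuit (Function.update φ 0 (φ 0 + Real.pi / 2)) =
      S.circuit φ * ((-Complex.I) • S.σ 0) := by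
  obtain ⟨m, rfl⟩ := Nat.exists_eq_succ_of_ne_zero (NeZero.ne M)
  have h := S.gate_add_pi_div_two 0 (φ 0)
  simp only [circuit, List.ofFn_succ, List.reverse_cons, List.prod_append, List.prod_singleton]
  have h2 : ∀ k : Fin m, Function.update φ 0 (φ 0 + Real.pi / 2) k.succ = φ k.succ :=
    fun k => Function.update_of_ne (Fin.succ_ne_zero k) _ _
  simp only [h2, Function.update_self, h, mul_assoc]

end Model

/-! ### Fidelities -/

theorem braket_smul_conjTranspose_add {n : ℕ} (φ ψ : Ket n) (A B X : Op n) (a b : ℝ) :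
    braket φ (((a : ℂ) • A + (b : ℂ) • B)ᴴ * X) ψ =
      a * braket φ (Aᴴ * X) ψ + b * braket φ (Bᴴ * X) ψ := by
  simp only [braket_eq_inner, Matrix.conjTranspose_add, Matrix.conjTranspose_smul, add_mul,
    Matrix.smul_mul, opCLM, map_add, map_smul, add_apply,
    smul_apply, inner_add_right, inner_smul_right, Complex.star_def,
    Complex.conj_ofReal]

theorem norm_ofReal_mul_add_sq (a b : ℝ) (z w : ℂ) :
    ‖(a : ℂ) * z + b * w‖ ^ 2 = a ^ 2 * ‖z‖ ^ 2 + b ^ 2 * ‖w‖ ^ 2 +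
      2 * (a * b) * (z.re * w.re + z.im * w.im) := by
  simp only [Complex.sq_norm, Complex.normSq_apply, Complex.add_re, Complex.add_im,
    Complex.mul_re, Complex.mul_im, Complex.ofReal_re, Complex.ofReal_im]
  ring

namespace Model

variable {n M : ℕ} (S : Model n M)

theorem continuous_braket_circuit (B : Op n) (ψ : Ket n) :
    Continuous fun φ => braket ψ ((S.circuit φ)ᴴ * B) ψ := by
  have := S.continuous_circuit
  unfold braket
  fun_prop

theorem isTrig_fidelity (B : Op n) (ψ : Ket n) :
    IsTrig fun φ => ‖braket ψ ((S.circuit φ)ᴴ * B) ψ‖ ^ 2 where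
  continuous := (S.continuous_braket_circuit B ψ).norm.pow 2
  update_add φ i c t := by
    rw [S.circuit_update_add φ i c t, S.circuit_update_add φ i c (Real.pi / 4)]
    simp only [braket_smul_conjTranspose_add, norm_ofReal_mul_add_sq, Real.cos_pi_div_four,
      Real.sin_pi_div_four]
    have h : √2 ^ 2 = (2 : ℝ) := Real.sq_sqrt zero_le_two
    -- The cross term is recovered from the value at `c + π / 4`.
    linear_combination (-(Real.sin t * Real.cos t) / 2 *
      (‖braket ψ ((S.circuit (Function.update φ i c))ᴴ * B) ψ‖ ^ 2 +
      ‖braket ψ ((S.circuit (Function.update φ i (c + Real.pi / 2)))ᴴ * B) ψ‖ ^ 2 +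
      2 * ((braket ψ ((S.circuit (Function.update φ i c))ᴴ * B) ψ).re *
        (braket ψ ((S.circuit (Function.update φ i (c + Real.pi / 2)))ᴴ * B) ψ).re +
      (braket ψ ((S.circuit (Function.update φ i c))ᴴ * B) ψ).im *
        (braket ψ ((S.circuit (Function.update φ i (c + Real.pi / 2)))ᴴ * B) ψ).im))) * h

theorem norm_state (j : Fin 3) : ‖S.state j‖ = 1 := by
  have h0 := S.orthonormal.1 0
  have h1 := S.orthonormal.1 1
  have h01 : inner ℂ (S.init 0) (S.init 1) = 0 := S.orthonormal.2 (by decide)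
  fin_cases j
  · simpa [state] using h0
  · simpa [state] using h1
  · have h2 := norm_add_sq_eq_norm_sq_add_norm_sq_of_inner_eq_zero _ _ h01
    have h3 : ‖S.init 0 + S.init 1‖ = √2 := by
      rw [← Real.sqrt_sq (norm_nonneg (S.init 0 + S.init 1)), sq, h2, h0, h1]
      norm_num
    change ‖((√2 : ℝ) : ℂ)⁻¹ • (S.init 0 + S.init 1)‖ = 1
    rw [norm_smul, h3, norm_inv, Complex.norm_real, Real.norm_of_nonneg (Real.sqrt_nonneg 2)]
    exact inv_mul_cancel₀ (by positivity)

/-- Two orthonormal states exist only if there is at least one qubit. -/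
theorem one_le {n M : ℕ} (S : Model n M) : 1 ≤ n := by
  have h := S.orthonormal.linearIndependent.fintype_card_le_finrank
  rcases Nat.eq_zero_or_pos n with rfl | hn
  · simp at h
  · exact hn

theorem maxAbsEnergy_nonneg : 0 ≤ S.maxAbsEnergy :=
  Real.iSup_nonneg fun _ => abs_nonneg _

/-- The average of the three fidelities, so that the cost is one minus this. -/
noncomputable def meanFidelity (φbar : Fin M → ℝ) (δt : ℝ) (φ : Fin M → ℝ) : ℝ :=
  (1 / 3) * ∑ j,
    ‖braket (S.state j) ((S.circuit φ)ᴴ * (S.evolution δt * S.circuit φbar)) (S.state j)‖ ^ 2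

theorem cost_eq (φbar : Fin M → ℝ) (δt : ℝ) (φ : Fin M → ℝ) :
    S.cost φbar δt φ = 1 - S.meanFidelity φbar δt φ := by
  simp only [cost, costTerm, meanFidelity, Finset.sum_sub_distrib, mul_assoc]
  simp
  ring

theorem isTrig_meanFidelity (φbar : Fin M → ℝ) (δt : ℝ) : IsTrig (S.meanFidelity φbar δt) :=
  (IsTrig.sum _ fun _ _ => S.isTrig_fidelity _ _).const_mul _

theorem evolution_mem_unitaryGroup (δt : ℝ) :
    S.evolution δt ∈ Matrix.unitaryGroup (Bits n) ℂ :=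
  exp_mem_unitaryGroup S.isHermitian δt

theorem meanFidelity_nonneg (φbar : Fin M → ℝ) (δt : ℝ) (φ : Fin M → ℝ) :
    0 ≤ S.meanFidelity φbar δt φ :=
  mul_nonneg (by norm_num) (Finset.sum_nonneg fun _ _ => sq_nonneg _)

theorem meanFidelity_le_one (φbar : Fin M → ℝ) (δt : ℝ) (φ : Fin M → ℝ) :
    S.meanFidelity φbar δt φ ≤ 1 := by
  have h : ∀ j ∈ Finset.univ, ‖braket (S.state j)
      ((S.circuit φ)ᴴ * (S.evolution δt * S.circuit φbar)) (S.state j)‖ ^ 2 ≤ 1 := fun j _ =>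
    pow_le_one₀ (norm_nonneg _) (norm_braket_conjTranspose_mul_le (S.circuit_mem_unitaryGroup φ)
      (mul_mem (S.evolution_mem_unitaryGroup δt) (S.circuit_mem_unitaryGroup φbar))
      (S.norm_state j) (S.norm_state j))
  have h2 := Finset.sum_le_card_nsmul _ _ _ h
  simp only [Finset.card_univ, Fintype.card_fin, nsmul_eq_mul] at h2
  rw [meanFidelity]
  norm_num at h2 ⊢
  linarith

/-! ### Overlaps and the gap at the centre -/

theorem σ_isHermitian (i : Fin M) : (S.σ i).IsHermitian := pauliString_isHermitian _

theorem σ_mem_unitaryGroup (i : Fin M) : S.σ i ∈ Matrix.unitaryGroup (Bits n) ℂ :=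
  pauliString_mem_unitaryGroup _

theorem braket_σ_eq_inner (i : Fin M) (ψ : Ket n) :
    braket ψ (S.σ i) ψ = inner ℂ (opCLM (S.σ i) ψ) ψ := by
  have h := braket_conjTranspose_mul ψ (S.σ i) 1 ψ
  rw [(S.σ_isHermitian i).eq, mul_one] at h
  simpa [opCLM] using h

theorem norm_braket_σ_le_one (i : Fin M) {ψ : Ket n} (hψ : ‖ψ‖ = 1) :
    ‖braket ψ (S.σ i) ψ‖ ≤ 1 := by
  rw [braket_σ_eq_inner]
  refine (norm_inner_le_norm _ _).trans ?_
  rw [norm_opCLM_of_mem_unitaryGroup (S.σ_mem_unitaryGroup _), hψ, one_mul]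

theorem trace_σ_density (i : Fin M) (ψ : Ket n) :
    (Matrix.trace (S.σ i * density ψ * S.σ i * density ψ)).re = ‖braket ψ (S.σ i) ψ‖ ^ 2 := by
  have hreal : (starRingEnd ℂ) (braket ψ (S.σ i) ψ) = braket ψ (S.σ i) ψ := by
    conv_lhs => rw [braket_eq_inner, inner_conj_symm]
    rw [braket_σ_eq_inner]
  have h : Matrix.trace (S.σ i * density ψ * S.σ i * density ψ) = braket ψ (S.σ i) ψ ^ 2 := by
    rw [mul_assoc (S.σ i * density ψ), density, Matrix.mul_vecMulVec,
      Matrix.vecMulVec_mul_vecMulVec, Matrix.trace_vecMulVec, dotProduct_smul, smul_eq_mul, sq,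
      braket, dotProduct_comm (S.σ i *ᵥ ψ.ofLp)]
  have him := Complex.conj_eq_iff_im.1 hreal
  rw [h, Complex.sq_norm, Complex.normSq_apply, sq, Complex.mul_re, him]
  ring

theorem meanOverlap_eq [NeZero M] :
    S.meanOverlap = (1 / 3) * ∑ j, ‖braket (S.state j) (S.σ 0) (S.state j)‖ ^ 2 := by
  simp only [meanOverlap, trace_σ_density]

theorem meanOverlap_nonneg [NeZero M] : 0 ≤ S.meanOverlap := by
  rw [meanOverlap_eq]
  exact mul_nonneg (by norm_num) (Finset.sum_nonneg fun _ _ => sq_nonneg _)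

/-- One state with a strict overlap suffices: the other two contribute at most `1` each, and
`(1 - ε)² ≤ 1 - ε`. -/
theorem meanOverlap_le [NeZero M] {ε : ℝ}
    (h : ∃ j, ‖braket (S.state j) (S.σ 0) (S.state j)‖ ≤ 1 - ε) :
    S.meanOverlap ≤ 1 - ε / 3 := by
  obtain ⟨j, hj⟩ := h
  have h1 := fun k => S.norm_braket_σ_le_one 0 (S.norm_state k)
  have h2 : ‖braket (S.state j) (S.σ 0) (S.state j)‖ ^ 2 ≤ 1 - ε := by
    nlinarith [h1 j, norm_nonneg (braket (S.state j) (S.σ 0) (S.state j))]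
  have h3 : ∑ k ∈ Finset.univ.erase j, ‖braket (S.state k) (S.σ 0) (S.state k)‖ ^ 2 ≤ 2 := by
    have := Finset.sum_le_card_nsmul (Finset.univ.erase j)
      (fun k => ‖braket (S.state k) (S.σ 0) (S.state k)‖ ^ 2) 1
      fun k _ => pow_le_one₀ (norm_nonneg _) (h1 k)
    simpa [Finset.card_erase_of_mem] using this
  rw [meanOverlap_eq, ← Finset.add_sum_erase _ _ (Finset.mem_univ j)]
  linarith

/-- The evolved state stays close to the old optimum, and the flipped state `σ₁ ψ` has an overlap
with it close to `⟨ψ|σ₁|ψ⟩`. -/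
theorem fidelity_gap [NeZero M] (φbar : Fin M → ℝ) {δt : ℝ} (hδ : 0 ≤ δt) {ψ : Ket n}
    (hψ : ‖ψ‖ = 1) :
    1 - ‖braket ψ (S.σ 0) ψ‖ ^ 2 - 2 * S.maxAbsEnergy * δt -
        2 * S.maxAbsEnergy ^ 2 * δt ^ 2 ≤
      ‖braket ψ ((S.circuit φbar)ᴴ * (S.evolution δt * S.circuit φbar)) ψ‖ ^ 2 -
      ‖braket ψ ((S.circuit (Function.update φbar 0 (φbar 0 + Real.pi / 2)))ᴴ *
        (S.evolution δt * S.circuit φbar)) ψ‖ ^ 2 := by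
  set x := S.maxAbsEnergy * δt with hx
  have hx0 : 0 ≤ x := mul_nonneg S.maxAbsEnergy_nonneg hδ
  set U := S.circuit φbar
  have hU : U ∈ Matrix.unitaryGroup (Bits n) ℂ := S.circuit_mem_unitaryGroup φbar
  set ξ := opCLM U ψ with hξ
  set η := opCLM (S.evolution δt) ξ with hη
  have hξ1 : ‖ξ‖ = 1 := (norm_opCLM_of_mem_unitaryGroup hU ψ).trans hψ
  have hη1 : ‖η‖ = 1 :=
    (norm_opCLM_of_mem_unitaryGroup (S.evolution_mem_unitaryGroup δt) ξ).trans hξ1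
  have hd : ‖η - ξ‖ ≤ x := by simpa [hξ1] using norm_evolution_sub_le S hδ ξ
  have hB : opCLM (S.evolution δt * U) ψ = η := by
    rw [opCLM, map_mul, mul_apply_eq_comp]
  -- Two unit vectors at distance at most `x` have an inner product of real part at least
  -- `1 - x² / 2`; the squared bound is trivial once `x² > 2`.
  have ha : 1 - x ^ 2 ≤ ‖inner ℂ ξ η‖ ^ 2 := by
    have h1 := norm_sub_sq (𝕜 := ℂ) ξ η
    rw [norm_sub_rev, hξ1, hη1] at h1
    have h2 : ‖η - ξ‖ ^ 2 ≤ x ^ 2 := by gcongr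
    have h3 : RCLike.re (inner ℂ ξ η) ≤ ‖inner ℂ ξ η‖ := RCLike.re_le_norm _
    rcases le_or_gt (x ^ 2) 2 with h4 | h4
    · nlinarith [norm_nonneg (inner ℂ ξ η)]
    · nlinarith [sq_nonneg ‖inner ℂ ξ η‖]
  have hσ1 : ‖opCLM U (opCLM (S.σ 0) ψ)‖ = 1 := by
    rw [norm_opCLM_of_mem_unitaryGroup hU,
      norm_opCLM_of_mem_unitaryGroup (S.σ_mem_unitaryGroup _), hψ]
  have hb : ‖inner ℂ (opCLM (S.circuit (Function.update φbar 0 (φbar 0 + Real.pi / 2))) ψ) η‖ ≤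
      ‖braket ψ (S.σ 0) ψ‖ + x := by
    have h1 : opCLM (S.circuit (Function.update φbar 0 (φbar 0 + Real.pi / 2))) ψ =
        (-Complex.I) • opCLM U (opCLM (S.σ 0) ψ) := by
      rw [S.circuit_update_zero φbar, opCLM, map_mul, map_smul, mul_apply_eq_comp,
        smul_apply, map_smul]
    have h2 : inner ℂ (opCLM U (opCLM (S.σ 0) ψ)) ξ = braket ψ (S.σ 0) ψ := by
      rw [hξ, ← braket_conjTranspose_mul, ← Matrix.star_eq_conjTranspose,
        Matrix.mem_unitaryGroup_iff'.1 hU, braket_eq_inner, braket_σ_eq_inner]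
      simp [opCLM]
    have h3 : η = ξ + (η - ξ) := by abel
    rw [h1, inner_smul_left, norm_mul, h3, inner_add_right, h2]
    have h4 : ‖inner ℂ (opCLM U (opCLM (S.σ 0) ψ)) (η - ξ)‖ ≤ x := by
      refine (norm_inner_le_norm _ _).trans ?_
      rwa [hσ1, one_mul]
    rw [RCLike.norm_conj, norm_neg, Complex.norm_I, one_mul]
    exact (norm_add_le _ _).trans (by gcongr)
  rw [braket_conjTranspose_mul, braket_conjTranspose_mul, hB]
  have ho := S.norm_braket_σ_le_one 0 hψ
  have ho0 := norm_nonneg (braket ψ (S.σ 0) ψ)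
  have hb2 := pow_le_pow_left₀ (norm_nonneg _) hb 2
  have h5 : ‖braket ψ (S.σ 0) ψ‖ * x ≤ x := mul_le_of_le_one_left hx0 ho
  have h6 : S.maxAbsEnergy ^ 2 * δt ^ 2 = x ^ 2 := by rw [hx]; ring
  nlinarith

theorem margin_le_gap [NeZero M] (φbar : Fin M → ℝ) {δt : ℝ} (hδ : 0 ≤ δt) :
    S.margin δt ≤ S.meanFidelity φbar δt φbar -
      S.meanFidelity φbar δt (Function.update φbar 0 (φbar 0 + Real.pi / 2)) := by
  have h := fun j => S.fidelity_gap φbar hδ (S.norm_state j)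
  rw [margin, meanOverlap_eq, meanFidelity, meanFidelity]
  simp only [Fin.sum_univ_three]
  linarith [h 0, h 1, h 2]

theorem margin_le_one [NeZero M] {δt : ℝ} (hδ : 0 ≤ δt) : S.margin δt ≤ 1 := by
  have h1 := S.meanOverlap_nonneg
  have h2 : 0 ≤ S.maxAbsEnergy * δt := mul_nonneg S.maxAbsEnergy_nonneg hδ
  rw [margin]
  nlinarith

/-! ### The margin and the variance of the cost -/

/-- The condition on the time step is the positivity of the margin, a quadratic polynomial in
`2 |E_m| δt`, made quantitative by the factor `κ`. -/
theorem margin_ge [NeZero M] {δt κ : ℝ} (hδ : 0 ≤ δt) (hκ : 0 ≤ κ) (hκ1 : κ ≤ 1)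
    (hs : S.meanOverlap ≤ 1)
    (hA : 2 * S.maxAbsEnergy * δt ≤ κ * (√(3 - 2 * S.meanOverlap) - 1)) :
    (1 - κ) * (1 - S.meanOverlap) ≤ S.margin δt := by
  have h2 : 0 ≤ S.maxAbsEnergy * δt := mul_nonneg S.maxAbsEnergy_nonneg hδ
  have h3 : √(3 - 2 * S.meanOverlap) ^ 2 = 3 - 2 * S.meanOverlap := Real.sq_sqrt (by linarith)
  have h4 : 1 ≤ √(3 - 2 * S.meanOverlap) := Real.one_le_sqrt.2 (by linarith)
  set y := √(3 - 2 * S.meanOverlap) - 1 with hy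
  have hy0 : 0 ≤ y := by linarith
  have h5 : y ^ 2 + 2 * y = 2 * (1 - S.meanOverlap) := by
    rw [hy]; linear_combination h3
  set x := 2 * S.maxAbsEnergy * δt with hx
  have hx0 : 0 ≤ x := by linarith
  have h6 : S.margin δt = (y ^ 2 + 2 * y - x ^ 2 - 2 * x) / 2 := by
    rw [margin, h5]; ring
  have h7 : x ^ 2 ≤ (κ * y) ^ 2 := by gcongr
  have h8 : κ ^ 2 * y ^ 2 ≤ κ * y ^ 2 := by
    have : κ ^ 2 ≤ κ := by nlinarith
    gcongr
  rw [h6]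
  nlinarith

theorem margin_pos [NeZero M] {δt : ℝ} (hδ : 0 ≤ δt)
    (hA : 2 * S.maxAbsEnergy * δt < √(3 - 2 * S.meanOverlap) - 1) : 0 < S.margin δt := by
  have h2 : 0 ≤ S.maxAbsEnergy * δt := mul_nonneg S.maxAbsEnergy_nonneg hδ
  have h4 : 1 + 2 * (S.maxAbsEnergy * δt) < √(3 - 2 * S.meanOverlap) := by linarith
  have h5 := (Real.lt_sqrt (by linarith)).1 h4
  rw [margin]
  nlinarith

theorem variance_cost_ge [NeZero M] (φbar : Fin M → ℝ) {δt r r₀ : ℝ} (hδ : 0 ≤ δt)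
    (hA : 2 * S.maxAbsEnergy * δt < √(3 - 2 * S.meanOverlap) - 1) (h₀ : 0 < r₀) (h₁ : r₀ < 1)
    (hr : 0 < r)
    (hB : ((M : ℝ) - 1) * r ^ 2 ≤ 3 * r₀ ^ 2 * (S.margin δt / (1 + S.margin δt))) :
    4 * r ^ 4 / 45 * (1 - 4 * r ^ 2 / 7) * (1 - r₀ ^ 2) ^ 2 * S.margin δt ^ 2 ≤
      variance (S.cost φbar δt) (uniformCube φbar r) := by
  have := isProbabilityMeasure_uniformCube φbar hr
  have hF := S.isTrig_meanFidelity φbar δt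
  have h := hF.variance_ge_of_gap (S.meanFidelity_nonneg φbar δt) (S.meanFidelity_le_one φbar δt)
    φbar hr (by nlinarith) 0 (S.margin_pos hδ hA).le (S.margin_le_gap φbar hδ) hB
  have hc : S.cost φbar δt = fun φ => 1 - S.meanFidelity φbar δt φ := funext (S.cost_eq φbar δt)
  rwa [hc, variance_const_sub hF.continuous.aestronglyMeasurable]

end Model

end VQS

theorem mainTheorem3 :
    -- the quantitative lower bound
    (∀ (n M : ℕ) [NeZero M] (S : VQS.Model n M) (φbar : Fin M → ℝ) (δt r r₀ : ℝ),
      0 ≤ δt →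
      2 * S.maxAbsEnergy * δt < Real.sqrt (3 - 2 * S.meanOverlap) - 1 →
      0 < r₀ → r₀ < 1 → 0 < r →
      ((M : ℝ) - 1) * r ^ 2 ≤ 3 * r₀ ^ 2 * (S.margin δt / (1 + S.margin δt)) →
      4 * r ^ 4 / 45 * (1 - 4 * r ^ 2 / 7) * (1 - r₀ ^ 2) ^ 2 * S.margin δt ^ 2 ≤
        ProbabilityTheory.variance (S.cost φbar δt) (VQS.uniformCube φbar r)) ∧
    -- the scaling statement, for an overlap gap that is at least `1 / p(n)`
    (∀ (p : Polynomial ℝ), VQS.PosPoly p → ∀ r₀ : ℝ, 0 < r₀ → r₀ < 1 →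
      -- perturbations of order `1 / √M`, up to polynomial factors in `n`, are allowed
      (∀ κ : ℝ, 0 < κ → κ < 1 → ∃ b : ℝ, 0 < b ∧
        ∀ (n M : ℕ) [NeZero M] (S : VQS.Model n M) (δt r : ℝ),
          (∃ j, ‖VQS.braket (S.state j) (S.σ 0) (S.state j)‖ ≤ 1 - 1 / p.eval (n : ℝ)) →
          0 ≤ δt →
          2 * S.maxAbsEnergy * δt ≤ κ * (Real.sqrt (3 - 2 * S.meanOverlap) - 1) →
          0 < r → r ≤ b / Real.sqrt (M * p.eval (n : ℝ)) →
          ((M : ℝ) - 1) * r ^ 2 ≤ 3 * r₀ ^ 2 * (S.margin δt / (1 + S.margin δt))) ∧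
      -- and for these the variance is at least of order `1 / (M² poly(n))`
      (∀ q : Polynomial ℝ, VQS.PosPoly q → ∃ P : Polynomial ℝ, VQS.PosPoly P ∧
        ∀ (n M : ℕ) [NeZero M] (S : VQS.Model n M) (φbar : Fin M → ℝ) (δt r : ℝ),
          2 ≤ M →
          (∃ j, ‖VQS.braket (S.state j) (S.σ 0) (S.state j)‖ ≤ 1 - 1 / p.eval (n : ℝ)) →
          0 ≤ δt →
          2 * S.maxAbsEnergy * δt < Real.sqrt (3 - 2 * S.meanOverlap) - 1 →
          1 / (q.eval (n : ℝ) * Real.sqrt M) ≤ r →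
          ((M : ℝ) - 1) * r ^ 2 ≤ 3 * r₀ ^ 2 * (S.margin δt / (1 + S.margin δt)) →
          1 / ((M : ℝ) ^ 2 * P.eval (n : ℝ)) ≤
            ProbabilityTheory.variance (S.cost φbar δt) (VQS.uniformCube φbar r))) := by
  refine ⟨fun n M _ S φbar δt r r₀ hδ hA h₀ h₁ hr hB =>
    S.variance_cost_ge φbar hδ hA h₀ h₁ hr hB, fun p hp r₀ h₀ h₁ => ⟨fun κ hκ hκ1 => ?_,
    fun q hq => ?_⟩⟩
  · refine ⟨r₀ * (1 - κ) / 2, by have := sub_pos.2 hκ1; positivity,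
      fun n M _ S δt r hj hδ hA hr hrb => ?_⟩
    have hpn : 0 < p.eval (n : ℝ) := hp n S.one_le
    have hM : (1 : ℝ) ≤ M := by exact_mod_cast NeZero.one_le
    have hs := S.meanOverlap_le hj
    have hε : 0 < 1 / p.eval (n : ℝ) := by positivity
    have hD := S.margin_ge hδ hκ.le hκ1.le (by linarith) hA
    have hD1 := S.margin_le_one hδ
    set D := S.margin δt
    set ε := 1 / p.eval (n : ℝ) with hεp
    have hD2 : (1 - κ) * (ε / 3) ≤ D :=
      (mul_le_mul_of_nonneg_left (by linarith) (by linarith)).trans hD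
    have hD0 : 0 < D := lt_of_lt_of_le (mul_pos (by linarith) (by positivity)) hD2
    -- Since `D ≤ 1`, the right hand side of the condition on `r` is at least `3 r₀² D / 2`.
    have hfrac : D / 2 ≤ D / (1 + D) := div_le_div_of_nonneg_left hD0.le (by linarith) (by linarith)
    have hr2 : M * r ^ 2 ≤ (r₀ * (1 - κ) / 2) ^ 2 * ε := by
      have h1 := pow_le_pow_left₀ hr.le hrb 2
      rw [div_pow, Real.sq_sqrt (by positivity), le_div_iff₀ (by positivity)] at h1
      rw [hεp, mul_one_div, le_div_iff₀ hpn]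
      linarith
    have hκ2 : (1 - κ) ^ 2 ≤ 1 - κ := by nlinarith
    have h2 : r₀ ^ 2 * ε * (1 - κ) ^ 2 ≤ r₀ ^ 2 * ε * (1 - κ) := by gcongr
    have h3 : 3 * r₀ ^ 2 * ((1 - κ) * (ε / 3) / 2) ≤ 3 * r₀ ^ 2 * (D / (1 + D)) := by
      gcongr
      linarith
    have h4 : 0 ≤ r₀ ^ 2 * ε * (1 - κ) ^ 2 := by positivity
    nlinarith [sq_nonneg r]
  · have hc : 0 < 1 - r₀ ^ 2 := by nlinarith
    -- The constant is `45 * 7 * 36 / 4 = 2835`: the margin is at least `1 / (6 q²)`, and the factor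
    -- `1 - 4 r² / 7` is at least `1 / 7`.
    refine ⟨Polynomial.C (2835 / (1 - r₀ ^ 2) ^ 2) * q ^ 8, fun n hn => ?_,
      fun n M _ S φbar δt r hM2 _ hδ hA hrq hB => ?_⟩
    · have := hq n hn
      simp only [Polynomial.eval_mul, Polynomial.eval_C, Polynomial.eval_pow]
      positivity
    have hqn : 0 < q.eval (n : ℝ) := hq n S.one_le
    have hM : (2 : ℝ) ≤ M := by exact_mod_cast hM2
    have hM0 : (0 : ℝ) < M := by linarith
    have hr : 0 < r := lt_of_lt_of_le (by positivity) hrq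
    have hvar := S.variance_cost_ge φbar hδ hA h₀ h₁ hr hB
    refine le_trans ?_ hvar
    have hD0 := S.margin_pos hδ hA
    have hD1 := S.margin_le_one hδ
    set D := S.margin δt
    simp only [Polynomial.eval_mul, Polynomial.eval_C, Polynomial.eval_pow]
    set Q := q.eval (n : ℝ)
    have hr2 : 1 / (Q ^ 2 * M) ≤ r ^ 2 := by
      have h1 := pow_le_pow_left₀ (by positivity) hrq 2
      rwa [div_pow, one_pow, mul_pow, Real.sq_sqrt hM0.le] at h1
    have hr0 : r₀ ^ 2 ≤ 1 := by linarith
    have hfrac0 : 0 ≤ D / (1 + D) := by positivity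
    have hB' : (M - 1 : ℝ) * r ^ 2 ≤ 3 * (D / (1 + D)) := hB.trans (by nlinarith)
    have hfrac1 : D / (1 + D) ≤ 1 / 2 := by
      rw [div_le_div_iff₀ (by linarith) two_pos]; linarith
    have hfrac2 : D / (1 + D) ≤ D := div_le_self hD0.le (by linarith)
    have hr3 : r ^ 2 ≤ 3 / 2 := by nlinarith [sq_nonneg r]
    -- The upper bound on `r` forces the margin to be at least of the order of `M r²`.
    have hD2 : 1 / (6 * Q ^ 2) ≤ D := by
      have h1 : M / 2 * r ^ 2 ≤ (M - 1 : ℝ) * r ^ 2 := by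
        gcongr; linarith
      have h2 : M / 2 * (1 / (Q ^ 2 * M)) ≤ M / 2 * r ^ 2 := by gcongr
      have h3 : M / 2 * (1 / (Q ^ 2 * M)) = 3 * (1 / (6 * Q ^ 2)) := by field_simp; norm_num
      linarith
    calc 1 / ((M : ℝ) ^ 2 * (2835 / (1 - r₀ ^ 2) ^ 2 * Q ^ 8))
        = 4 * (1 / (Q ^ 2 * M)) ^ 2 / 45 * (1 / 7) * (1 - r₀ ^ 2) ^ 2 * (1 / (6 * Q ^ 2)) ^ 2 := by
          field_simp; norm_num
      _ ≤ 4 * (r ^ 2) ^ 2 / 45 * (1 - 4 * r ^ 2 / 7) * (1 - r₀ ^ 2) ^ 2 * D ^ 2 := by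
          have h7 : 1 / 7 ≤ 1 - 4 * r ^ 2 / 7 := by linarith
          gcongr
      _ = _ := by ring
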